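/- Let $n$ be a non-negative integer, let $|\cdot|$ denote the Euclidean norm on $\mathbb{R}^n$, and let $\|\cdot\|$ be an arbitrary norm on $\mathbb{R}^n$. A finite vector of points $(A_1,\dots,A_r)$ in $\mathbb{R}^n$, $r\ge 1$, is called self-contracted with respect to $\|\cdot\|$ if $\|A_k-A_j\|\le\|A_k-A_i\|$ whenever $1\le i\le j\le k\le r$. Then there is a constant $C>0$, depending only on $n$ and $\|\cdot\|$ (in particular not on $r$ or on the points), such that for every $r\ge 1$ and every vector $(A_1,\dots,A_r)$ of points in $\mathbb{R}^n$ that is self-contracted with respect to $\|\cdot\|$, $$\sum_{i=1}^{r-1}|A_{i+1}-A_i|\le C\,|A_r-A_1|.$$ -/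

import Mathlib

/-- The vector of points `(A 0, …, A (r - 1))` is self-contracted with respect to the
(semi)norm `N`. -/
def IsSelfContracted {n r : ℕ} (N : Seminorm ℝ (EuclideanSpace ℝ (Fin n)))
    (A : Fin r → EuclideanSpace ℝ (Fin n)) : Prop :=
  ∀ i j k : Fin r, i ≤ j → j ≤ k → N (A k - A j) ≤ N (A k - A i)

/-- The Euclidean length of the polygonal line with consecutive vertices
`A 0, A 1, …, A r`: the sum of the Euclidean lengths of its `r` edges. -/
noncomputable def polygonalLength {n r : ℕ} (A : Fin (r + 1) → EuclideanSpace ℝ (Fin n)) : ℝ :=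
  ∑ i : Fin r, dist (A i.castSucc) (A i.succ)

open Metric Finset

section Normed

variable {F : Type*} [NormedAddCommGroup F] [NormedSpace ℝ F]

/-! Fix `i`: self-contractedness makes the vectors `V k = A k - A i`, `k > i`, satisfy `‖V k - V j‖
≤ ‖V k‖` for `j ≤ k`. One functional, from a finite set depending only on the space, is then
uniformly positive on all of them (`exists_finite_functionals`). Over the indices `i` sharing a
functional, its increments along `A` control the edge lengths and telescope
(`sum_le_sub_of_forall_later`); summing over the finite set gives the bound. The given norm is
equivalent to the Euclidean one. -/

/-- A norming functional at `v` is almost norming at vectors of nearly the same direction. -/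
theorem norming_apply_ge {g : F →L[ℝ] ℝ} (hg : ‖g‖ ≤ 1) {v w : F} (hv : v ≠ 0) (hgv : g v = ‖v‖)
    (h : ‖(‖v‖⁻¹ • v) - (‖w‖⁻¹ • w)‖ ≤ 1 / 4) : 3 / 4 * ‖w‖ ≤ g w := by
  rcases eq_or_ne w 0 with rfl | hw
  · simp
  have hv' : 0 < ‖v‖ := norm_pos_iff.2 hv
  have hw' : 0 < ‖w‖ := norm_pos_iff.2 hw
  have h1 : g ((‖v‖⁻¹ • v) - (‖w‖⁻¹ • w)) ≤ 1 / 4 :=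
    (le_abs_self _).trans <| (g.le_of_opNorm_le hg _).trans (by simpa using h)
  rw [map_sub, map_smul, map_smul, hgv, smul_eq_mul, smul_eq_mul, inv_mul_cancel₀ hv'.ne',
    inv_mul_eq_div] at h1
  rw [← le_div_iff₀ hw']
  linarith

/-- If `‖V k - V j‖ ≤ ‖V k‖` for `j ≤ k` and the directions of the vectors `V j` fall into at
most `m` classes of small diameter, then some functional of norm less than `3 ^ m` is uniformly
positive on all of them. -/
theorem exists_functional_of_card_colors_le {ι κ : Type*} [LinearOrder ι] [DecidableEq κ]
    (V : ι → F) (col : ι → κ)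
    (hcol : ∀ j k, col j = col k → ‖(‖V k‖⁻¹ • V k) - (‖V j‖⁻¹ • V j)‖ ≤ 1 / 4) (m : ℕ) :
    ∀ J : Finset ι, (∀ j ∈ J, V j ≠ 0) → (∀ j ∈ J, ∀ k ∈ J, j ≤ k → ‖V k - V j‖ ≤ ‖V k‖) →
      (J.image col).card ≤ m →
        ∃ G : F →L[ℝ] ℝ, ‖G‖ ≤ 3 ^ m - 1 ∧ ∀ j ∈ J, 1 / 4 * ‖V j‖ ≤ G (V j) := by
  induction m with
  | zero =>
    intro J _ _ hm
    have hJ : J = ∅ := by simpa using hm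
    exact ⟨0, by simp, by simp [hJ]⟩
  | succ m ih =>
    intro J h0 hV hm
    rcases J.eq_empty_or_nonempty with rfl | hne
    · refine ⟨0, ?_, by simp⟩
      have : (1 : ℝ) ≤ 3 ^ (m + 1) := one_le_pow₀ (by norm_num)
      simpa using this
    set k := J.max' hne with hk
    have hkJ : k ∈ J := J.max'_mem hne
    obtain ⟨G', hG', hpos⟩ := ih {j ∈ J | col j ≠ col k}
      (fun j hj => h0 j (mem_filter.1 hj).1)
      (fun i hi j hj => hV i (mem_filter.1 hi).1 j (mem_filter.1 hj).1) (by
        have hsub : ({j ∈ J | col j ≠ col k}).image col ⊆ (J.image col).erase (col k) := by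
          intro c hc
          obtain ⟨j, hj, rfl⟩ := mem_image.1 hc
          exact mem_erase.2 ⟨(mem_filter.1 hj).2, mem_image_of_mem _ (mem_filter.1 hj).1⟩
        have := card_le_card hsub
        rw [card_erase_of_mem (mem_image_of_mem _ hkJ)] at this
        omega)
    -- As `V k` is the last vector, `g (V k - V j) ≤ ‖V k‖ = g (V k)`, so `g ≥ 0` on the whole
    -- family: adding multiples of `g` never spoils the other classes.
    obtain ⟨g, hg, hgk⟩ := exists_dual_vector'' ℝ (V k)
    replace hgk : g (V k) = ‖V k‖ := hgk
    have hB : (1 : ℝ) ≤ 3 ^ m := one_le_pow₀ (by norm_num)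
    -- On the class of `k`, `g` gains `2 * 3 ^ m * (3 / 4)`, outweighing a loss of at most `3 ^ m -
    -- 1` from `G'`.
    refine ⟨G' + (2 * 3 ^ m : ℝ) • g, ?_, fun j hj => ?_⟩
    · refine (norm_add_le _ _).trans ?_
      rw [norm_smul, Real.norm_of_nonneg (by positivity), pow_succ]
      nlinarith
    · rw [_root_.add_apply, _root_.smul_apply, smul_eq_mul]
      by_cases hc : col j = col k
      · have h1 := norming_apply_ge hg (h0 k hkJ) hgk (hcol j k hc)
        have h2 : -((3 ^ m - 1) * ‖V j‖) ≤ G' (V j) :=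
          (abs_le.1 (G'.le_of_opNorm_le hG' (V j))).1
        nlinarith [norm_nonneg (V j)]
      · have h1 := hpos j (mem_filter.2 ⟨hj, hc⟩)
        have h2 : 0 ≤ g (V j) := by
          have h3 := (le_abs_self _).trans (g.le_of_opNorm_le hg (V k - V j))
          rw [map_sub, hgk] at h3
          linarith [hV j hj k hkJ (J.le_max' j hj)]
        have : 0 ≤ 2 * 3 ^ m * g (V j) := by positivity
        linarith

/-- Increments dominated by every later increase of `x` add up to at most the total increase. -/
theorem sum_le_sub_of_forall_later {r : ℕ} (x : Fin (r + 1) → ℝ) (c : Fin r → ℝ) (m : ℝ)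
    (hm : ∀ k, m ≤ x k) (s : Finset (Fin r))
    (hc : ∀ i ∈ s, ∀ k, i.castSucc < k → c i ≤ x k - x i.castSucc) :
    ∑ i ∈ s, c i ≤ x (Fin.last r) - m := by
  suffices h : ∀ k, (∀ i ∈ s, i.castSucc < k) → ∑ i ∈ s, c i ≤ x k - m from
    h _ fun i _ => Fin.castSucc_lt_last i
  induction s using Finset.induction_on_max with
  | empty => intro k _; simpa using hm k
  | insert a s ha ih =>
    intro k hk
    rw [sum_insert fun h => lt_irrefl _ (ha a h)]
    have h1 := ih (fun i hi => hc i (mem_insert_of_mem hi)) a.castSucc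
      fun i hi => Fin.castSucc_lt_castSucc_iff.2 (ha i hi)
    have h2 := hc a (mem_insert_self _ _) k (hk a (mem_insert_self _ _))
    linarith

/-- There is a finite set of functionals such that, for every finite ordered family of vectors
with `‖V k - V j‖ ≤ ‖V k‖` for `j ≤ k`, one of them is uniformly positive on the family. -/
theorem exists_finite_functionals (F : Type*) [NormedAddCommGroup F] [NormedSpace ℝ F]
    [FiniteDimensional ℝ F] :
    ∃ T : Finset (F →L[ℝ] ℝ), ∀ {ι : Type} [LinearOrder ι] (V : ι → F) (J : Finset ι),
      (∀ j ∈ J, ∀ k ∈ J, j ≤ k → ‖V k - V j‖ ≤ ‖V k‖) →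
        ∃ G ∈ T, ∀ j ∈ J, 1 / 8 * ‖V j‖ ≤ G (V j) := by
  classical
  -- Directions near a common `1 / 8`-net point differ by at most `1 / 4`; approximating `G` in the
  -- dual costs half of the bound `1 / 4`.
  obtain ⟨D, -, hDfin, hD⟩ := (isCompact_closedBall (0 : F) 1).finite_cover_balls
    (show (0 : ℝ) < 1 / 8 by norm_num)
  lift D to Finset F using hDfin
  obtain ⟨T, -, hTfin, hT⟩ :=
    (isCompact_closedBall (0 : F →L[ℝ] ℝ) (3 ^ D.card - 1)).finite_cover_balls
      (show (0 : ℝ) < 1 / 8 by norm_num)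
  lift T to Finset (F →L[ℝ] ℝ) using hTfin
  refine ⟨T, fun {ι} _ V J hV => ?_⟩
  have hnear : ∀ j, ∃ d ∈ D, ‖(‖V j‖⁻¹ • V j) - d‖ < 1 / 8 := fun j => by
    have h1 : ‖V j‖⁻¹ • V j ∈ closedBall (0 : F) 1 := by
      rw [mem_closedBall_zero_iff, norm_smul, norm_inv, norm_norm]
      exact inv_mul_le_one
    simpa [mem_ball, dist_eq_norm] using hD h1
  choose col hcolD hcol using hnear
  obtain ⟨G, hG, hGV⟩ := exists_functional_of_card_colors_le V col (fun j k hjk => by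
      have h1 := hcol j
      have h2 := hcol k
      rw [hjk, norm_sub_rev] at h1
      have := norm_sub_le_norm_sub_add_norm_sub (‖V k‖⁻¹ • V k) (col k) (‖V j‖⁻¹ • V j)
      linarith) D.card {j ∈ J | V j ≠ 0} (fun j hj => (mem_filter.1 hj).2)
    (fun j hj k hk => hV j (mem_filter.1 hj).1 k (mem_filter.1 hk).1)
    (card_le_card (image_subset_iff.2 fun j _ => hcolD j))
  obtain ⟨G', hG', hlt⟩ : ∃ G' ∈ T, ‖G - G'‖ < 1 / 8 := by
    simpa [mem_ball, dist_eq_norm] using hT (mem_closedBall_zero_iff.2 hG)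
  refine ⟨G', hG', fun j hj => ?_⟩
  by_cases h0 : V j = 0
  · simp [h0]
  have h1 := hGV j (mem_filter.2 ⟨hj, h0⟩)
  have h2 := (le_abs_self _).trans ((G - G').le_of_opNorm_le hlt.le (V j))
  rw [_root_.sub_apply] at h2
  linarith

/-- In a finite-dimensional normed space the length of a self-contracted polygonal line is
bounded by a constant times the distance between its ends. -/
theorem exists_sum_norm_le_of_selfContracted (F : Type*) [NormedAddCommGroup F]
    [NormedSpace ℝ F] [FiniteDimensional ℝ F] :
    ∃ C : ℝ, 0 ≤ C ∧ ∀ (r : ℕ) (A : Fin (r + 1) → F),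
      (∀ i j k, i ≤ j → j ≤ k → ‖A k - A j‖ ≤ ‖A k - A i‖) →
        ∑ i : Fin r, ‖A i.succ - A i.castSucc‖ ≤ C * ‖A (Fin.last r) - A 0‖ := by
  classical
  obtain ⟨T, hT⟩ := exists_finite_functionals F
  refine ⟨∑ G ∈ T, 16 * ‖G‖, by positivity, fun r A hA => ?_⟩
  have hG : ∀ i : Fin r, ∃ G ∈ T, ∀ k, i.castSucc < k →
      1 / 8 * ‖A k - A i.castSucc‖ ≤ G (A k - A i.castSucc) := fun i => by
    obtain ⟨G, hGT, h⟩ := hT (fun k => A k - A i.castSucc) (Finset.Ioi i.castSucc)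
      fun j hj k _ hjk => by simpa using hA _ j k (Finset.mem_Ioi.1 hj).le hjk
    exact ⟨G, hGT, fun k hk => h k (Finset.mem_Ioi.2 hk)⟩
  choose G hGT hGA using hG
  rw [← sum_fiberwise_of_maps_to (fun i _ => hGT i), sum_mul]
  refine sum_le_sum fun g _ => ?_
  -- An edge at `i` is at most `2 * ‖A k - A i‖` for every later `k`, hence `1 / 16`. The lower
  -- bound for `g (A k)` holds since no point is farther from the last one than `A 0`.
  have h := sum_le_sub_of_forall_later (fun k => g (A k))
    (fun i => 1 / 16 * ‖A i.succ - A i.castSucc‖)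
    (g (A (Fin.last r)) - ‖g‖ * ‖A (Fin.last r) - A 0‖) (fun k => by
      have h1 := (le_abs_self _).trans (g.le_opNorm (A (Fin.last r) - A k))
      have h2 := mul_le_mul_of_nonneg_left
        (hA 0 k (Fin.last r) (Fin.zero_le k) (Fin.le_last k)) (norm_nonneg g)
      rw [map_sub] at h1
      linarith) {i | G i = g} (fun i hi k hk => by
      have h1 := hGA i k hk
      rw [(mem_filter.1 hi).2, map_sub] at h1
      have h2 := hA _ i.succ k i.castSucc_lt_succ.le (Fin.castSucc_lt_iff_succ_le.1 hk)
      have h3 := norm_sub_le_norm_sub_add_norm_sub (A i.succ) (A k) (A i.castSucc)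
      rw [norm_sub_rev (A i.succ) (A k)] at h3
      linarith)
  rw [← mul_sum] at h
  linarith

end Normed

/-- A real vector space with a definite seminorm is isometric to a normed space. -/
theorem Seminorm.exists_normedSpace_equiv.{u} {E : Type u} [AddCommGroup E] [Module ℝ E]
    (N : Seminorm ℝ E) (hN : ∀ x, N x = 0 → x = 0) :
    ∃ (F : Type u) (_ : NormedAddCommGroup F) (_ : NormedSpace ℝ F) (e : E ≃ₗ[ℝ] F),
      ∀ x, ‖e x‖ = N x :=
  let i : NormedAddCommGroup E := AddGroupNorm.toNormedAddCommGroup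
    { N.toAddGroupSeminorm with eq_zero_of_map_eq_zero' := hN }
  ⟨E, i, { norm_smul_le := fun a x => (map_smul_eq_mul N a x).le },
    LinearEquiv.refl ℝ E, fun _ => rfl⟩

theorem mainTheorem1 (n : ℕ) (N : Seminorm ℝ (EuclideanSpace ℝ (Fin n)))
    (hN : ∀ x, N x = 0 → x = 0) :
    ∃ C : ℝ, 0 < C ∧ ∀ (r : ℕ) (A : Fin (r + 1) → EuclideanSpace ℝ (Fin n)),
      IsSelfContracted N A →
        polygonalLength A ≤ C * dist (A 0) (A (Fin.last r)) := by
  obtain ⟨F, _, _, e₀, he₀⟩ := N.exists_normedSpace_equiv hN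
  have : FiniteDimensional ℝ F := e₀.finiteDimensional
  let e := e₀.toContinuousLinearEquiv
  have he : ∀ x, ‖e x‖ = N x := he₀
  set a := ‖(e : EuclideanSpace ℝ (Fin n) →L[ℝ] F)‖
  set b := ‖(e.symm : F →L[ℝ] EuclideanSpace ℝ (Fin n))‖
  have ha : ∀ x, ‖e x‖ ≤ a * ‖x‖ :=
    (e : EuclideanSpace ℝ (Fin n) →L[ℝ] F).le_opNorm
  have hb : ∀ x, ‖x‖ ≤ b * ‖e x‖ := fun x => by
    simpa using (e.symm : F →L[ℝ] EuclideanSpace ℝ (Fin n)).le_opNorm (e x)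
  obtain ⟨C, hC, h⟩ := exists_sum_norm_le_of_selfContracted F
  have ha0 : 0 ≤ a := norm_nonneg _
  have hb0 : 0 ≤ b := norm_nonneg _
  -- The `+ 1` keeps the constant positive when `n = 0`, where `a = b = 0`.
  refine ⟨b * (C * a) + 1, by positivity, fun r A hA => ?_⟩
  have h1 := h r (fun i => e (A i)) fun i j k hij hjk => by
    rw [← map_sub, ← map_sub, he, he]
    exact hA i j k hij hjk
  calc polygonalLength A
      ≤ ∑ i : Fin r, b * ‖e (A i.succ) - e (A i.castSucc)‖ := by
        refine sum_le_sum fun i _ => ?_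
        rw [dist_comm, dist_eq_norm, ← map_sub]
        exact hb _
    _ ≤ b * (C * (a * ‖A (Fin.last r) - A 0‖)) := by
        rw [← mul_sum]
        refine mul_le_mul_of_nonneg_left (h1.trans ?_) hb0
        rw [← map_sub]
        exact mul_le_mul_of_nonneg_left (ha _) hC
    _ ≤ (b * (C * a) + 1) * dist (A 0) (A (Fin.last r)) := by
        rw [dist_comm, dist_eq_norm]
        linarith [norm_nonneg (A (Fin.last r) - A 0)]
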